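/- For a unital complex Banach algebra $\mathfrak A$, an element $e\in\mathfrak A$ is called Hermitian if $\|\exp(ite)\|=1$ for every $t\in\mathbb R$. A bounded operator $T$ on a complex Banach space $E$ is called Hermitian if it is a Hermitian element of the Banach algebra of all bounded operators on $E$. Let $X$ be a compact Hausdorff space and let $B$ be a unital point separating subalgebra of $C(X)$ (complex valued continuous functions) equipped with a Banach algebra norm. We call $B$ natural if $x\mapsto\phi_x$, $\phi_x(f)=f(x)$, is a bijection from $X$ onto the maximal ideal space of $B$, and self-adjoint if it is natural and closed under complex conjugation. Let $X,Y$ be compact Hausdorff spaces, let $B\subset C(X)$ and $\widetilde B\subset C(X\times Y)$ be unital point separating self-adjoint subalgebras, equipped with Banach algebra norms $\|\cdot\|_B$ and $\|\cdot\|_{\widetilde B}$, such that $B\otimes C(Y)\subset\widetilde B$, where $B\otimes C(Y)$ is the linear span of the functions $(f\otimes g)(x,y)=f(x)g(y)$ with $f\in B$, $g\in C(Y)$. Suppose that $\widetilde B$ is a natural $C(Y)$-valuezation of $B$, i.e. there are a compact Hausdorff space $\mathfrak M$ and a complex-linear map $D:\widetilde B\to C(\mathfrak M)$ such that $\ker D=1\otimes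 C(Y)=\{1\otimes g: g\in C(Y)\}$, $D$ maps real valued functions in $\widetilde B$ to real valued functions, and $$\|F\|_{\widetilde B}=\|F\|_{\infty(X\times Y)}+\|D(F)\|_{\infty(\mathfrak M)},\qquad F\in\widetilde B.$$ Proposition 7.3. A bounded (complex-linear) operator $T$ on $\widetilde B$ is a Hermitian operator if and only if $T(1)$ is a Hermitian element of $\widetilde B$ and $T=M_{T(1)}$, where $M_{T(1)}$ is the operator $F\mapsto T(1)F$ of multiplication by $T(1)$. -/

import Mathlib

/-!
Differentiating `‖exp (itT)‖ = 1` at `t = 0` shows that a Hermitian operator takes a real value on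
every vector under each of its support functionals. The norm of `Bt` has the support functionals
`F ↦ α F(p) + ψ (D F)`, and testing `T` on them at the constant function `1` gives that `T 1` is a
real function in the kernel of `D`. As this kernel is an algebra, `D` also kills `exp (it T 1)`, so
`T 1` and the multiplication by it are Hermitian.

The difference `S` of `T` and this multiplication kills the constants, and so does `D`. Adding
complex constants to a real function `F` with a maximum at `p` rotates the phase `α` without
changing `D F` or `S F`, which forces `(S F)(p) = 0`. By polarization `S` kills, at `p`, the
products of functions vanishing at `p`, so `S` is a bounded derivation. Hence `S = 0` by the
Singer–Wermer theorem.
-/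

universe u v w u₁ u₂

section HermitianElements

/-- An element `e` of a unital (complex) Banach algebra is Hermitian if `‖exp (i t e)‖ = 1` for
every real `t`. -/
def IsHermitianElement {A : Type*} [NormedRing A] [NormedAlgebra ℂ A] (e : A) : Prop :=
  ∀ t : ℝ, ‖NormedSpace.exp ((Complex.I * (t : ℂ)) • e)‖ = 1

/-- A bounded operator on a complex Banach space `E` is Hermitian if it is a Hermitian element of
the Banach algebra of all bounded operators on `E` (with the operator norm). -/
def IsHermitianOperator {E : Type*} [NormedAddCommGroup E] [NormedSpace ℂ E]
    (T : E →L[ℂ] E) : Prop :=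
  IsHermitianElement T

end HermitianElements

section FunctionAlgebras

variable {X : Type u} [TopologicalSpace X] [CompactSpace X] [T2Space X]
variable {B : Type u₁} [NormedCommRing B] [NormedAlgebra ℂ B] [CompleteSpace B]

/-- A Banach algebra `B` is presented as a unital subalgebra of `C(X)` with its own complete
algebra norm (unrelated a priori to the supremum norm) by its inclusion `ι`, a unital algebra
homomorphism into `C(X)`. This says that `ι` identifies `B` with a point separating unital
subalgebra of `C(X)`. -/
structure IsPointSeparatingSubalgebra (ι : B →ₐ[ℂ] C(X, ℂ)) : Prop where
  injective : Function.Injective ι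
  separates : ι.range.SeparatesPoints

/-- The point evaluation `φ_x : f ↦ f x`, as an element of the maximal ideal space `M_B`
(the space of characters of `B`). -/
noncomputable def evalCharacter (ι : B →ₐ[ℂ] C(X, ℂ)) (x : X) :
    WeakDual.characterSpace ℂ B :=
  WeakDual.CharacterSpace.equivAlgHom.symm ((ContinuousMap.evalAlgHom ℂ ℂ x).comp ι)

/-- `B` is natural if `x ↦ φ_x` is a bijection from `X` onto the maximal ideal space of `B`. -/
def IsNaturalAlgebra (ι : B →ₐ[ℂ] C(X, ℂ)) : Prop :=
  Function.Bijective (evalCharacter ι)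

/-- `B` is self-adjoint if it is natural and closed under complex conjugation. -/
structure IsSelfAdjointAlgebra (ι : B →ₐ[ℂ] C(X, ℂ)) : Prop where
  natural : IsNaturalAlgebra ι
  conj_mem : ∀ f : B, star (ι f) ∈ ι.range

end FunctionAlgebras

section Valuezations

variable {X : Type u} [TopologicalSpace X] [CompactSpace X] [T2Space X]
variable {Y : Type v} [TopologicalSpace Y] [CompactSpace Y] [T2Space Y]

/-- The function `(f ⊗ g)(x, y) = f x * g y` on `X × Y`. -/
noncomputable def tensorFun (f : C(X, ℂ)) (g : C(Y, ℂ)) : C(X × Y, ℂ) where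
  toFun p := f p.1 * g p.2

/-- `E ⊗ E'`: the space of all finite sums of functions `f ⊗ g`, `f ∈ E`, `g ∈ E'`. -/
noncomputable def tensorSpace (E : Submodule ℂ C(X, ℂ)) (E' : Submodule ℂ C(Y, ℂ)) :
    Submodule ℂ C(X × Y, ℂ) :=
  Submodule.span ℂ {h | ∃ f ∈ E, ∃ g ∈ E', h = tensorFun f g}

variable {B : Type u₁} [NormedCommRing B] [NormedAlgebra ℂ B] [CompleteSpace B]
variable {Bt : Type u₂} [NormedCommRing Bt] [NormedAlgebra ℂ Bt] [CompleteSpace Bt]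

/-- `Bt ⊆ C(X × Y)` (with inclusion `κ`) is a natural `C(Y)`-valuezation of `B ⊆ C(X)`
(with inclusion `ι`). -/
structure IsNaturalValuezation (ι : B →ₐ[ℂ] C(X, ℂ)) (κ : Bt →ₐ[ℂ] C(X × Y, ℂ)) : Prop where
  base_subalgebra : IsPointSeparatingSubalgebra ι
  base_selfAdjoint : IsSelfAdjointAlgebra ι
  subalgebra : IsPointSeparatingSubalgebra κ
  selfAdjoint : IsSelfAdjointAlgebra κ
  tensor_le : tensorSpace (Subalgebra.toSubmodule ι.range) (⊤ : Submodule ℂ C(Y, ℂ)) ≤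
    Subalgebra.toSubmodule κ.range
  exists_map : ∃ (M : Type w) (_ : TopologicalSpace M) (_ : CompactSpace M) (_ : T2Space M)
    (D : Bt →ₗ[ℂ] C(M, ℂ)),
      (∀ F : Bt, F ∈ LinearMap.ker D ↔ ∃ g : C(Y, ℂ), κ F = tensorFun 1 g) ∧
      (∀ F : Bt, (∀ p, (κ F p).im = 0) → ∀ m, (D F m).im = 0) ∧
      (∀ F : Bt, ‖F‖ = ‖κ F‖ + ‖D F‖)

end Valuezations

open scoped ComplexConjugate

section Exponential

variable {𝕜 : Type*} [RCLike 𝕜]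

theorem hasDerivAt_exp_smul_apply {E : Type*} [NormedAddCommGroup E] [NormedSpace 𝕜 E]
    [CompleteSpace E] (d : E →L[𝕜] E) (x : E) (z : 𝕜) :
    HasDerivAt (fun w : 𝕜 ↦ NormedSpace.exp (w • d) x) (d (NormedSpace.exp (z • d) x)) z := by
  simpa using (hasDerivAt_exp_smul_const' d z).clm_apply (hasDerivAt_const z x)

theorem eq_exp_smul_apply_of_hasDerivAt {E : Type*} [NormedAddCommGroup E] [NormedSpace 𝕜 E]
    [CompleteSpace E] {d : E →L[𝕜] E} {y : 𝕜 → E} (hy : ∀ z, HasDerivAt y (d (y z)) z) (z : 𝕜) :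
    y z = NormedSpace.exp (z • d) (y 0) := by
  let _ : NormedAlgebra ℚ (E →L[𝕜] E) := NormedAlgebra.restrictScalars ℚ 𝕜 _
  have hderiv : ∀ w, HasDerivAt (fun w ↦ NormedSpace.exp (w • -d) (y w)) 0 w := fun w ↦ by
    simpa using (hasDerivAt_exp_smul_const (-d) w).clm_apply (hy w)
  have hconst : NormedSpace.exp (z • -d) (y z) = y 0 := by
    simpa using is_const_of_deriv_eq_zero (fun w ↦ (hderiv w).differentiableAt)
      (fun w ↦ (hderiv w).deriv) z 0
  have hinv : NormedSpace.exp (z • d) * NormedSpace.exp (z • -d) = 1 := by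
    rw [← NormedSpace.exp_add_of_commute (by simp), smul_neg, add_neg_cancel, NormedSpace.exp_zero]
  rw [← hconst]
  exact (DFunLike.congr_fun hinv (y z)).symm

variable {A : Type*} [NormedRing A] [NormedAlgebra 𝕜 A] [CompleteSpace A]

theorem exp_smul_mul_eq_mul_exp_smul (a : A) (z : 𝕜) :
    NormedSpace.exp (z • ContinuousLinearMap.mul 𝕜 A a) =
      ContinuousLinearMap.mul 𝕜 A (NormedSpace.exp (z • a)) := by
  ext b
  have hderiv : ∀ w, HasDerivAt (fun w : 𝕜 ↦ NormedSpace.exp (w • a) * b)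
      (ContinuousLinearMap.mul 𝕜 A a (NormedSpace.exp (w • a) * b)) w := fun w ↦ by
    simpa [mul_assoc] using (hasDerivAt_exp_smul_const' a w).mul_const b
  simpa using (eq_exp_smul_apply_of_hasDerivAt hderiv z).symm

variable {d : A →L[𝕜] A} (hd : ∀ a b, d (a * b) = a * d b + d a * b)
include hd

theorem exp_smul_derivation_one (z : 𝕜) : NormedSpace.exp (z • d) (1 : A) = 1 := by
  have hd1 : d 1 = 0 := by simpa using hd 1 1
  exact (eq_exp_smul_apply_of_hasDerivAt (y := fun _ ↦ 1)
    (fun w ↦ by simpa [hd1] using hasDerivAt_const w (1 : A)) z).symm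

theorem exp_smul_derivation_mul (z : 𝕜) (a b : A) :
    NormedSpace.exp (z • d) (a * b) = NormedSpace.exp (z • d) a * NormedSpace.exp (z • d) b := by
  have hderiv : ∀ w, HasDerivAt
      (fun w : 𝕜 ↦ NormedSpace.exp (w • d) a * NormedSpace.exp (w • d) b)
      (d (NormedSpace.exp (w • d) a * NormedSpace.exp (w • d) b)) w := fun w ↦ by
    rw [hd, add_comm]
    exact (hasDerivAt_exp_smul_apply d a w).mul (hasDerivAt_exp_smul_apply d b w)
  simpa [zero_smul 𝕜 d] using (eq_exp_smul_apply_of_hasDerivAt hderiv z).symm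

end Exponential

/-- The **Singer–Wermer theorem** for a single character. -/
theorem map_derivation_eq_zero {A : Type*} [NormedRing A] [NormedAlgebra ℂ A] [CompleteSpace A]
    {d : A →L[ℂ] A} (hd : ∀ a b, d (a * b) = a * d b + d a * b) (φ : A →ₐ[ℂ] ℂ) (a : A) :
    φ (d a) = 0 := by
  have hderiv : ∀ z, HasDerivAt (fun z : ℂ ↦ φ (NormedSpace.exp (z • d) a))
      (φ (d (NormedSpace.exp (z • d) a))) z := fun z ↦
    φ.toContinuousLinearMap.hasFDerivAt.comp_hasDerivAt z (hasDerivAt_exp_smul_apply d a z)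
  -- `φ ∘ exp (z • d)` is again a character, so its norm is bounded independently of `z`.
  have hbound : ∀ z : ℂ, ‖φ (NormedSpace.exp (z • d) a)‖ ≤ ‖a‖ * ‖(1 : A)‖ := fun z ↦
    AlgHom.norm_apply_le_self_mul_norm_one (φ.comp (AlgHom.ofLinearMap
      (NormedSpace.exp (z • d)).toLinearMap (exp_smul_derivation_one hd z)
      (exp_smul_derivation_mul hd z))) a
  have hconst : ∀ z : ℂ, φ (NormedSpace.exp (z • d) a) = φ a := fun z ↦ by
    have hbdd : Bornology.IsBounded (Set.range fun z : ℂ ↦ φ (NormedSpace.exp (z • d) a)) :=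
      isBounded_iff_forall_norm_le.2 ⟨_, Set.forall_mem_range.2 hbound⟩
    have hdiff : Differentiable ℂ fun z : ℂ ↦ φ (NormedSpace.exp (z • d) a) :=
      fun w ↦ (hderiv w).differentiableAt
    simpa [zero_smul ℂ d] using hdiff.apply_eq_apply_of_bounded hbdd z 0
  have hderiv_zero : HasDerivAt (fun _ : ℂ ↦ φ a) (φ (d a)) 0 := by
    simpa [hconst, zero_smul ℂ d] using hderiv 0
  exact hderiv_zero.unique (hasDerivAt_const 0 (φ a))

section NumericalRange

variable {E : Type*} [NormedAddCommGroup E] [NormedSpace ℂ E]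

/-- The spatial numerical range of `T` is real: every support functional `φ` of a vector `x` takes
a real value at `T x`. To avoid normalizing, support functionals have norm at most `1` and satisfy
`φ x = ‖x‖`. -/
def HasRealNumericalRange (T : E →L[ℂ] E) : Prop :=
  ∀ (φ : StrongDual ℂ E) (x : E), ‖φ‖ ≤ 1 → φ x = ‖x‖ → (φ (T x)).im = 0

theorem HasRealNumericalRange.sub {T U : E →L[ℂ] E} (hT : HasRealNumericalRange T)
    (hU : HasRealNumericalRange U) : HasRealNumericalRange (T - U) := fun φ x hφ hx ↦ by
  simp [hT φ x hφ hx, hU φ x hφ hx]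

theorem IsHermitianOperator.hasRealNumericalRange [CompleteSpace E] {T : E →L[ℂ] E}
    (hT : IsHermitianOperator T) : HasRealNumericalRange T := by
  intro φ x hφ hx
  let f : ℝ → ℝ := fun t ↦ (φ (NormedSpace.exp ((t : ℂ) • Complex.I • T) x)).re
  have hderiv : HasDerivAt f (φ (Complex.I • T x)).re 0 := by
    simpa [f] using (φ.hasFDerivAt.comp_hasDerivAt ((0 : ℝ) : ℂ)
      (hasDerivAt_exp_smul_apply (Complex.I • T) x ((0 : ℝ) : ℂ))).real_of_complex
  have hmax : IsLocalMax f 0 := Filter.Eventually.of_forall fun t ↦ by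
    have hnorm : ‖NormedSpace.exp ((t : ℂ) • Complex.I • T)‖ = 1 := by
      simpa only [smul_smul, mul_comm] using hT t
    calc f t ≤ ‖φ (NormedSpace.exp ((t : ℂ) • Complex.I • T) x)‖ := Complex.re_le_norm _
      _ ≤ ‖NormedSpace.exp ((t : ℂ) • Complex.I • T) x‖ := by simpa using φ.le_of_opNorm_le hφ _
      _ ≤ ‖x‖ := by
        simpa only [hnorm, one_mul] using
          (NormedSpace.exp ((t : ℂ) • Complex.I • T)).le_opNorm x
      _ = f 0 := by simp [f, hx]
  simpa using hmax.hasDerivAt_eq_zero hderiv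

end NumericalRange

section HermitianMultiplication

variable {A : Type*} [NormedRing A] [NormedAlgebra ℂ A]

theorem IsHermitianElement.norm_one {e : A} (he : IsHermitianElement e) : ‖(1 : A)‖ = 1 := by
  simpa using he 0

theorem IsHermitianOperator.nontrivial {E : Type*} [NormedAddCommGroup E] [NormedSpace ℂ E]
    {T : E →L[ℂ] E} (hT : IsHermitianOperator T) : Nontrivial E := by
  by_contra! hE
  have hone : ‖(1 : E →L[ℂ] E)‖ = 1 := IsHermitianElement.norm_one hT
  simp [Subsingleton.elim (1 : E →L[ℂ] E) 0] at hone

theorem IsHermitianElement.isHermitianOperator_mul [CompleteSpace A] {a : A}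
    (ha : IsHermitianElement a) : IsHermitianOperator (ContinuousLinearMap.mul ℂ A a) := fun t ↦ by
  have : NormOneClass A := ⟨ha.norm_one⟩
  rw [exp_smul_mul_eq_mul_exp_smul, ContinuousLinearMap.opNorm_mul_apply, ha t]

theorem isHermitianElement_of_isSelfAdjoint {A : Type*} [CStarAlgebra A] [Nontrivial A] {a : A}
    (ha : IsSelfAdjoint a) : IsHermitianElement a := fun t ↦ by
  let b : selfAdjoint A := t • ⟨a, ha⟩
  simpa [b, mul_smul] using CStarRing.norm_coe_unitary (selfAdjoint.expUnitary b)

end HermitianMultiplication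

theorem norm_mul_conj_sub_ofReal_le {u : ℂ} (hu : ‖u‖ = 1) {R δ : ℝ} (hR : 0 ≤ R) (hδ : 0 ≤ δ)
    (hδR : δ ≤ 2 * (R * u.re)) : ‖R * conj u - δ‖ ≤ R := by
  have hu_sq : u.re * u.re + u.im * u.im = 1 := by
    rw [← Complex.normSq_apply, Complex.normSq_eq_norm_sq, hu, one_pow]
  refine le_of_sq_le_sq ?_ hR
  calc ‖R * conj u - δ‖ ^ 2
      = R ^ 2 * (u.re * u.re + u.im * u.im) - δ * (2 * (R * u.re) - δ) := by
        rw [← Complex.normSq_eq_norm_sq, Complex.normSq_apply]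
        simp only [Complex.sub_re, Complex.sub_im, Complex.re_ofReal_mul, Complex.im_ofReal_mul,
          Complex.conj_re, Complex.conj_im, Complex.ofReal_re, Complex.ofReal_im]
        ring
    _ ≤ R ^ 2 := by
        rw [hu_sq, mul_one]
        exact sub_le_self _ (mul_nonneg hδ (sub_nonneg.2 hδR))

/-- Subtracting `f p` and adding a large multiple of `conj u` makes the maximum of a real function
`f` the point of largest modulus, with phase `conj u`. -/
theorem exists_mul_eval_add_const_eq_norm {K : Type*} [TopologicalSpace K] [CompactSpace K]
    {f : C(K, ℂ)} (hf : IsSelfAdjoint f) {p : K} (hp : ∀ q, (f q).re ≤ (f p).re) {u : ℂ}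
    (hu : ‖u‖ = 1) (hu0 : 0 < u.re) :
    ∃ c : ℂ, u * (f + algebraMap ℂ C(K, ℂ) c) p = ‖f + algebraMap ℂ C(K, ℂ) c‖ := by
  set R : ℝ := ‖f‖ / u.re with hR
  have hR0 : 0 ≤ R := by positivity
  set g : C(K, ℂ) := f + algebraMap ℂ C(K, ℂ) (R * conj u - f p) with hg
  have hgp : g p = R * conj u := by simp [hg]
  have hgq : ∀ q, g q = R * conj u - ((f p).re - (f q).re : ℝ) := fun q ↦ by
    have hre : ∀ q, ((f q).re : ℂ) = f q := fun q ↦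
      Complex.conj_eq_iff_re.1 (DFunLike.congr_fun hf q)
    rw [Complex.ofReal_sub, hre, hre]
    simp only [hg, ContinuousMap.add_apply, algebraMap_apply, smul_eq_mul, mul_one]
    ring
  have hosc : ∀ q, (f p).re - (f q).re ≤ 2 * (R * u.re) := fun q ↦ by
    have hpf := (Complex.abs_re_le_norm _).trans (f.norm_coe_le_norm p)
    have hqf := (Complex.abs_re_le_norm _).trans (f.norm_coe_le_norm q)
    rw [hR, div_mul_cancel₀ _ hu0.ne']
    linarith [le_abs_self (f p).re, neg_abs_le (f q).re]
  have hnormg : ‖g‖ = R := by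
    refine le_antisymm ((ContinuousMap.norm_le _ hR0).2 fun q ↦ ?_) ?_
    · rw [hgq]
      exact norm_mul_conj_sub_ofReal_le hu hR0 (sub_nonneg.2 (hp q)) (hosc q)
    · simpa [hgp, hu, abs_of_nonneg hR0] using g.norm_coe_le_norm p
  refine ⟨R * conj u - f p, ?_⟩
  rw [← hg, hnormg, hgp, mul_left_comm, Complex.mul_conj, Complex.normSq_eq_norm_sq, hu, one_pow,
    Complex.ofReal_one, mul_one]

section SupPlusSeminorm

variable {K : Type*} [TopologicalSpace K] [CompactSpace K]
variable {A : Type*} [NormedCommRing A] [NormedAlgebra ℂ A]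
variable {V : Type*} [NormedAddCommGroup V] [NormedSpace ℂ V]
variable {κ : A →ₐ[ℂ] C(K, ℂ)} {D : A →ₗ[ℂ] V} (hnorm : ∀ F : A, ‖F‖ = ‖κ F‖ + ‖D F‖)
variable {T S : A →L[ℂ] A}
include hnorm

theorem HasRealNumericalRange.im_eval_add_eq_zero (hT : HasRealNumericalRange T) {F : A} {p : K}
    {α : ℂ} (hα : ‖α‖ ≤ 1) (hαF : α * κ F p = ‖κ F‖) {ψ : StrongDual ℂ V} (hψ : ‖ψ‖ ≤ 1)
    (hψF : ψ (D F) = ‖D F‖) : (α * κ (T F) p + ψ (D (T F))).im = 0 := by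
  let φ : A →ₗ[ℂ] ℂ :=
    α • ((ContinuousMap.evalAlgHom ℂ ℂ p).comp κ).toLinearMap + ψ.toLinearMap ∘ₗ D
  have hφ : ∀ G, ‖φ G‖ ≤ 1 * ‖G‖ := fun G ↦ by
    have hκG : ‖α * κ G p‖ ≤ ‖κ G‖ := by
      simpa using mul_le_mul hα ((κ G).norm_coe_le_norm p) (norm_nonneg _) zero_le_one
    have hψG : ‖ψ (D G)‖ ≤ ‖D G‖ := by simpa using ψ.le_of_opNorm_le hψ (D G)
    rw [one_mul, hnorm]
    exact (norm_add_le _ _).trans (add_le_add hκG hψG)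
  refine hT (φ.mkContinuous 1 hφ) F (φ.mkContinuous_norm_le zero_le_one hφ) ?_
  change α * κ F p + ψ (D F) = ‖F‖
  rw [hαF, hψF, hnorm, Complex.ofReal_add]

theorem HasRealNumericalRange.isSelfAdjoint_map_one (hD1 : D 1 = 0)
    (hT : HasRealNumericalRange T) : IsSelfAdjoint (κ (T 1)) := by
  ext p
  have : Nonempty K := ⟨p⟩
  refine Complex.conj_eq_iff_im.2 ?_
  simpa using hT.im_eval_add_eq_zero hnorm (F := 1) (p := p) (α := 1) (ψ := 0) (by simp) (by simp)
    (by simp) (by simp [hD1])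

theorem HasRealNumericalRange.map_one_mem_ker [Nonempty K] (hD1 : D 1 = 0)
    (hT : HasRealNumericalRange T) : D (T 1) = 0 := by
  obtain ⟨ψ, hψ, hψT⟩ := exists_dual_vector'' ℂ (D (T 1))
  obtain ⟨p⟩ := ‹Nonempty K›
  have hre : (κ (T 1) p).im = 0 :=
    Complex.conj_eq_iff_im.1 (DFunLike.congr_fun (hT.isSelfAdjoint_map_one hnorm hD1) p)
  -- `D 1 = 0`, so the phase of `ψ` is free.
  have him := hT.im_eval_add_eq_zero hnorm (F := 1) (p := p) (α := 1) (ψ := Complex.I • ψ)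
    (by simp) (by simp) (by simpa [norm_smul] using hψ) (by simp [hD1])
  simpa [hre, hψT] using him

theorem isHermitianElement_of_mem_ker [CompleteSpace A] [Nonempty K] {R : Subalgebra ℂ A}
    (hR : Subalgebra.toSubmodule R = LinearMap.ker D) {a : A} (ha : IsSelfAdjoint (κ a))
    (hDa : D a = 0) : IsHermitianElement a := by
  intro t
  let _ : NormedAlgebra ℚ A := NormedAlgebra.restrictScalars ℚ ℂ A
  have hκ : Continuous κ := AddMonoidHomClass.continuous_of_bound κ 1 fun F ↦ by
    simp [hnorm]
  have hD : Continuous D := AddMonoidHomClass.continuous_of_bound D 1 fun F ↦ by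
    simp [hnorm]
  have hmem : ∀ F, F ∈ R ↔ D F = 0 := fun F ↦ by
    rw [← Subalgebra.mem_toSubmodule, hR, LinearMap.mem_ker]
  have hclosed : IsClosed (R : Set A) := by
    convert isClosed_singleton.preimage hD (t := {0})
    ext F
    simp [hmem]
  have hexpD : D (NormedSpace.exp ((Complex.I * t) • a)) = 0 :=
    (hmem _).1 (NormedSpace.exp_mem (R := ℂ) hclosed (R.smul_mem ((hmem a).2 hDa) _))
  rw [hnorm, hexpD, norm_zero, add_zero, NormedSpace.map_exp κ hκ, map_smul]
  exact isHermitianElement_of_isSelfAdjoint ha t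

section VanishingAtOne

variable (hD1 : D 1 = 0) (hS : HasRealNumericalRange S) (hS1 : S 1 = 0)
include hD1 hS hS1

theorem HasRealNumericalRange.map_apply_eq_zero_of_isMax {F : A} (hF : IsSelfAdjoint (κ F))
    {p : K} (hp : ∀ q, (κ F q).re ≤ (κ F p).re) : κ (S F) p = 0 := by
  obtain ⟨ψ, hψ, hψF⟩ := exists_dual_vector'' ℂ (D F)
  have hphase : ∀ u : ℂ, ‖u‖ = 1 → 0 < u.re → (u * κ (S F) p + ψ (D (S F))).im = 0 := by
    intro u hu hu0
    obtain ⟨c, hc⟩ := exists_mul_eval_add_const_eq_norm hF hp hu hu0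
    have hDc : D (F + algebraMap ℂ A c) = D F := by simp [Algebra.algebraMap_eq_smul_one, hD1]
    have hSc : S (F + algebraMap ℂ A c) = S F := by simp [Algebra.algebraMap_eq_smul_one, hS1]
    have hκc : κ (F + algebraMap ℂ A c) = κ F + algebraMap ℂ C(K, ℂ) c := by
      rw [map_add, AlgHom.commutes]
    simpa only [hSc] using hS.im_eval_add_eq_zero hnorm (F := F + algebraMap ℂ A c) hu.le
      (by rw [hκc, hc]) hψ (by rw [hDc, hψF]; rfl)
  -- For `z = κ (S F) p`, the numbers `im (u * z)` agree for these three `u`, so `z = 0`.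
  have hone := hphase 1 (by simp) (by simp)
  have hplus := hphase ⟨3 / 5, 4 / 5⟩
    (by rw [Complex.norm_def]; norm_num [Complex.normSq_apply]) (by norm_num)
  have hminus := hphase ⟨3 / 5, -4 / 5⟩
    (by rw [Complex.norm_def]; norm_num [Complex.normSq_apply]) (by norm_num)
  simp only [Complex.add_im, Complex.mul_im, one_mul] at hone hplus hminus
  refine Complex.ext ?_ ?_
  · rw [Complex.zero_re]
    linarith
  · rw [Complex.zero_im]
    linarith

theorem HasRealNumericalRange.map_mul_conj_apply_eq_zero {F F' : A} (hF : κ F' = star (κ F))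
    {p : K} (hp : κ F p = 0) : κ (S (F * F')) p = 0 := by
  have hsq : ∀ q, κ (-(F * F')) q = (-‖κ F q‖ ^ 2 : ℝ) := fun q ↦ by
    simp [hF, Complex.mul_conj, Complex.normSq_eq_norm_sq]
  have hreal : IsSelfAdjoint (κ (-(F * F'))) := by
    ext q
    rw [ContinuousMap.star_apply, hsq]
    exact Complex.conj_ofReal _
  have hmax := hS.map_apply_eq_zero_of_isMax hnorm hD1 hS1 hreal (p := p) fun q ↦ by
    rw [hsq, hsq, Complex.ofReal_re, Complex.ofReal_re, hp]
    simp
  simpa using hmax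

variable (hconj : ∀ F : A, star (κ F) ∈ κ.range)
include hconj

theorem HasRealNumericalRange.map_mul_apply_eq_zero {F G : A} {p : K} (hF : κ F p = 0)
    (hG : κ G p = 0) : κ (S (F * G)) p = 0 := by
  obtain ⟨F', hF' : κ F' = star (κ F)⟩ := hconj F
  obtain ⟨G', hG' : κ G' = star (κ G)⟩ := hconj G
  have hG'p : κ G' p = 0 := by simp [hG', hG]
  have hsq : ∀ {H H' : A}, κ H' = star (κ H) → κ H p = 0 → κ (S (H * H')) p = 0 :=
    fun hH hp ↦ hS.map_mul_conj_apply_eq_zero hnorm hD1 hS1 hH hp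
  have hFF := hsq hF' hF
  have hGG := hsq (H := G') (H' := G) (by rw [hG', star_star]) hG'p
  have hadd := hsq (H := F + G') (H' := F' + G) (by simp [hF', hG']) (by simp [hF, hG'p])
  have haddI := hsq (H := F + Complex.I • G') (H' := F' - Complex.I • G)
    (by simp [hF', hG', sub_eq_add_neg]) (by simp [hF, hG'p])
  have hexpand : (F + G') * (F' + G) = F * F' + F * G + (G' * F' + G' * G) := by ring
  have hexpandI : (F + Complex.I • G') * (F' - Complex.I • G) =
      F * F' - Complex.I • (F * G) + Complex.I • (G' * F') -
        (Complex.I * Complex.I) • (G' * G) := by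
    simp only [Algebra.smul_def, map_mul]
    ring
  simp only [hexpand, hexpandI, map_add, map_sub, map_smul, ContinuousMap.add_apply,
    ContinuousMap.sub_apply, ContinuousMap.smul_apply, smul_eq_mul, hFF, hGG] at hadd haddI
  have hdiff : κ (S (G' * F')) p = κ (S (F * G)) p :=
    mul_left_cancel₀ Complex.I_ne_zero (by linear_combination haddI)
  linear_combination (1 / 2) * hadd - (1 / 2) * hdiff

theorem HasRealNumericalRange.leibniz (hκ : Function.Injective κ) (F G : A) :
    S (F * G) = F * S G + S F * G := by
  refine hκ (ContinuousMap.ext fun p ↦ ?_)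
  have hvanish := hS.map_mul_apply_eq_zero hnorm hD1 hS1 hconj (p := p)
    (F := F - algebraMap ℂ A (κ F p)) (G := G - algebraMap ℂ A (κ G p)) (by simp) (by simp)
  have hexpand : ∀ a b : ℂ, (F - algebraMap ℂ A a) * (G - algebraMap ℂ A b) =
      F * G - b • F - a • G + (a * b) • 1 := fun a b ↦ by
    simp only [Algebra.smul_def, map_mul]
    ring
  simp only [hexpand, map_add, map_sub, map_smul, hS1, smul_zero, add_zero,
    ContinuousMap.sub_apply, ContinuousMap.smul_apply, smul_eq_mul] at hvanish
  simp only [map_add, map_mul, ContinuousMap.add_apply, ContinuousMap.mul_apply]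
  linear_combination hvanish

theorem HasRealNumericalRange.eq_zero [CompleteSpace A] (hκ : Function.Injective κ) : S = 0 := by
  ext F
  refine hκ (ContinuousMap.ext fun p ↦ ?_)
  simpa using map_derivation_eq_zero (hS.leibniz hnorm hD1 hS1 hconj hκ)
    ((ContinuousMap.evalAlgHom ℂ ℂ p).comp κ) F

end VanishingAtOne

end SupPlusSeminorm

theorem proposition7p3_general {K : Type*} [TopologicalSpace K] [CompactSpace K]
    {A : Type*} [NormedCommRing A] [NormedAlgebra ℂ A] [CompleteSpace A]
    {V : Type*} [NormedAddCommGroup V] [NormedSpace ℂ V]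
    {κ : A →ₐ[ℂ] C(K, ℂ)} (hκ : Function.Injective κ) (hconj : ∀ F : A, star (κ F) ∈ κ.range)
    {D : A →ₗ[ℂ] V} {R : Subalgebra ℂ A} (hR : Subalgebra.toSubmodule R = LinearMap.ker D)
    (hnorm : ∀ F : A, ‖F‖ = ‖κ F‖ + ‖D F‖) (T : A →L[ℂ] A) :
    IsHermitianOperator T ↔
      (IsHermitianElement (T 1) ∧ T = ContinuousLinearMap.mul ℂ A (T 1)) := by
  refine ⟨fun hT ↦ ?_, fun ⟨hT1, hT⟩ ↦ hT ▸ hT1.isHermitianOperator_mul⟩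
  have := hT.nontrivial
  have : Nonempty K := by
    by_contra! hK
    exact not_subsingleton A hκ.subsingleton
  have hD1 : D 1 = 0 := LinearMap.mem_ker.1 (hR ▸ R.one_mem)
  have hTreal := hT.hasRealNumericalRange
  have hT1 : IsHermitianElement (T 1) := isHermitianElement_of_mem_ker hnorm hR
    (hTreal.isSelfAdjoint_map_one hnorm hD1) (hTreal.map_one_mem_ker hnorm hD1)
  have hsub := hTreal.sub hT1.isHermitianOperator_mul.hasRealNumericalRange
  exact ⟨hT1, sub_eq_zero.1 (hsub.eq_zero hnorm hD1 (by simp) hconj hκ)⟩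

theorem tensorFun_one {X Y : Type*} [TopologicalSpace X] [TopologicalSpace Y] (g : C(Y, ℂ)) :
    tensorFun (1 : C(X, ℂ)) g = g.comp ContinuousMap.snd := by
  ext p
  simp [tensorFun]

theorem proposition7p3
    {X : Type u} [TopologicalSpace X] [CompactSpace X] [T2Space X]
    {Y : Type v} [TopologicalSpace Y] [CompactSpace Y] [T2Space Y]
    {B : Type u₁} [NormedCommRing B] [NormedAlgebra ℂ B] [CompleteSpace B]
    {Bt : Type u₂} [NormedCommRing Bt] [NormedAlgebra ℂ Bt] [CompleteSpace Bt]
    (ι : B →ₐ[ℂ] C(X, ℂ)) (κ : Bt →ₐ[ℂ] C(X × Y, ℂ))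
    (h : IsNaturalValuezation.{u, v, w, u₁, u₂} ι κ)
    (T : Bt →L[ℂ] Bt) :
    IsHermitianOperator T ↔
      (IsHermitianElement (T 1) ∧ T = ContinuousLinearMap.mul ℂ Bt (T 1)) := by
  obtain ⟨M, _, _, _, D, hker, -, hnorm⟩ := h.exists_map
  refine proposition7p3_general h.subalgebra.injective h.selfAdjoint.conj_mem (D := D)
    (R := (ContinuousMap.compRightAlgHom ℂ ℂ ContinuousMap.snd).range.comap κ) ?_ hnorm T
  ext F
  simp [hker, tensorFun_one, eq_comm]
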